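/- Let $f\in\mathcal S'(\mathbb R^2)$ be a (complex) tempered distribution. For $\alpha\in(-1,1)$ let $\Sigma_\alpha:=\begin{pmatrix}1&\alpha\\ \alpha&1\end{pmatrix}$, which is positive definite, and let $\phi_{\Sigma_\alpha}\in\mathcal S(\mathbb R^2)$ be the centered Gaussian density with covariance matrix $\Sigma_\alpha$, $$\phi_{\Sigma_\alpha}(x)=\big[(2\pi)^2\det\Sigma_\alpha\big]^{-1/2}e^{-\frac12\langle x,\Sigma_\alpha^{-1}x\rangle},\qquad x\in\mathbb R^2 .$$ Then, for all $\alpha\in(-1,1)$ and $x\in\mathbb R^2$, $$\phi_{\Sigma_\alpha}(x)=\big(2\pi\sqrt{1-\alpha^2}\big)^{-1}e^{-\frac{1}{2(1-\alpha^2)}(x_1^2+x_2^2-2\alpha x_1x_2)} .$$ Moreover, the function $\Theta_f:(-1,1)\to\mathbb C$, $\Theta_f(\alpha):=\langle f,\phi_{\Sigma_\alpha}\rangle_{\mathcal S',\mathcal S}$, is smooth ($C^\infty$), and for every integer $n\ge 0$ and every $\alpha\in(-1,1)$ its $n$-th derivative is $$\Theta_f^{(n)}(\alpha)=\Big\langle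 \frac{\partial^{2n}f}{\partial x_1^n\,\partial x_2^n},\ \phi_{\Sigma_\alpha}\Big\rangle_{\mathcal S',\mathcal S},$$ where $\partial^{2n}f/\partial x_1^n\partial x_2^n$ denotes the distributional derivative and $\langle\cdot,\cdot\rangle_{\mathcal S',\mathcal S}$ the bilinear dual pairing. -/

import Mathlib

open scoped SchwartzMap LineDeriv ContDiff

noncomputable section

namespace PriceTheorem

/-- The density `x ↦ [(2π)ᵈ det S]^(-1/2) exp(-⟨x, S⁻¹ x⟩ / 2)` of the centered normal
distribution on `ℝᵈ` with (positive definite) covariance matrix `S`. -/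
def gaussianDensity {d : ℕ} (S : Matrix (Fin d) (Fin d) ℝ) (x : EuclideanSpace ℝ (Fin d)) : ℝ :=
  ((2 * Real.pi) ^ d * S.det) ^ (-(1 / 2) : ℝ) *
    Real.exp (-(1 / 2) * (x.ofLp ⬝ᵥ S⁻¹.mulVec x.ofLp))

theorem quadForm_hasTemperateGrowth {d : ℕ} (M : Matrix (Fin d) (Fin d) ℝ) :
    Function.HasTemperateGrowth
      (fun x : EuclideanSpace ℝ (Fin d) ↦ -(1 / 2) * (x.ofLp ⬝ᵥ M.mulVec x.ofLp)) := by
  have h : (fun x : EuclideanSpace ℝ (Fin d) ↦ -(1 / 2) * (x.ofLp ⬝ᵥ M.mulVec x.ofLp)) =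
      fun x ↦ ∑ i, ∑ j, ((fun _ : EuclideanSpace ℝ (Fin d) ↦ -(1 / 2) * M i j) *
        (⇑(EuclideanSpace.proj i : EuclideanSpace ℝ (Fin d) →L[ℝ] ℝ) *
          ⇑(EuclideanSpace.proj j : EuclideanSpace ℝ (Fin d) →L[ℝ] ℝ))) x := by
    funext x
    simp only [dotProduct, Matrix.mulVec, Finset.mul_sum, Pi.mul_apply, PiLp.proj_apply]
    refine Finset.sum_congr rfl fun i _ ↦ Finset.sum_congr rfl fun j _ ↦ ?_
    ring
  rw [h]
  refine Function.HasTemperateGrowth.sum fun i _ ↦ Function.HasTemperateGrowth.sum fun j _ ↦ ?_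
  exact (Function.HasTemperateGrowth.const _).mul
    ((ContinuousLinearMap.hasTemperateGrowth _).mul (ContinuousLinearMap.hasTemperateGrowth _))

theorem quadForm_coercive {d : ℕ} {M : Matrix (Fin d) (Fin d) ℝ} (hM : M.PosDef) :
    ∃ c : ℝ, 0 < c ∧ ∀ x : EuclideanSpace ℝ (Fin d),
      -(1 / 2) * (x.ofLp ⬝ᵥ M.mulVec x.ofLp) ≤ -(c * ‖x‖ ^ 2) := by
  have hpos : ∀ x : EuclideanSpace ℝ (Fin d), x ≠ 0 → 0 < x.ofLp ⬝ᵥ M.mulVec x.ofLp := by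
    intro x hx
    have := hM.dotProduct_mulVec_pos (x := x.ofLp) (by simpa using hx)
    simpa using this
  have hcont : Continuous (fun x : EuclideanSpace ℝ (Fin d) ↦ x.ofLp ⬝ᵥ M.mulVec x.ofLp) := by
    have := (quadForm_hasTemperateGrowth M).1.continuous.const_smul (-2 : ℝ)
    refine this.congr fun x ↦ ?_
    change (-2 : ℝ) * (-(1 / 2) * (x.ofLp ⬝ᵥ M.mulVec x.ofLp)) = _
    ring
  rcases (Metric.sphere (0 : EuclideanSpace ℝ (Fin d)) 1).eq_empty_or_nonempty with he | hne
  · refine ⟨1, one_pos, fun x ↦ ?_⟩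
    have hx : x = 0 := by
      by_contra hx
      have : (‖x‖⁻¹ • x) ∈ Metric.sphere (0 : EuclideanSpace ℝ (Fin d)) 1 := by
        simp [norm_smul, hx]
      simp [he] at this
    simp [hx]
  · obtain ⟨y, hy, hmin⟩ := (isCompact_sphere (0 : EuclideanSpace ℝ (Fin d)) 1).exists_isMinOn
      hne hcont.continuousOn
    have hy0 : y ≠ 0 := by
      rintro rfl
      simp at hy
    refine ⟨(y.ofLp ⬝ᵥ M.mulVec y.ofLp) / 2, by have := hpos y hy0; positivity, fun x ↦ ?_⟩
    by_cases hx : x = 0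
    · simp [hx]
    have hxn : 0 < ‖x‖ := norm_pos_iff.mpr hx
    have hmem : (‖x‖⁻¹ • x) ∈ Metric.sphere (0 : EuclideanSpace ℝ (Fin d)) 1 := by
      simp [norm_smul, hx]
    have h := hmin hmem
    simp only [Set.mem_ofPred_eq, WithLp.ofLp_smul, Matrix.mulVec_smul, smul_dotProduct,
      dotProduct_smul, smul_eq_mul] at h
    have h2 := mul_le_mul_of_nonneg_right h (sq_nonneg ‖x‖)
    have h3 : ‖x‖⁻¹ * (‖x‖⁻¹ * (x.ofLp ⬝ᵥ M.mulVec x.ofLp)) * ‖x‖ ^ 2 =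
        x.ofLp ⬝ᵥ M.mulVec x.ofLp := by
      field_simp
    rw [h3] at h2
    linarith

theorem pow_mul_exp_neg_sq_le {c : ℝ} (hc : 0 < c) (m : ℕ) :
    ∃ C : ℝ, ∀ t : ℝ, 0 ≤ t → (1 + t) ^ m * Real.exp (-(c * t ^ 2)) ≤ C := by
  refine ⟨m.factorial / c ^ m * Real.exp (2 * c), fun t ht ↦ ?_⟩
  have h1 := Real.pow_div_factorial_le_exp (c * (1 + t)) (by positivity) m
  have h2 : (1 + t) ^ m ≤ m.factorial / c ^ m * Real.exp (c * (1 + t)) := by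
    rw [div_le_iff₀ (by positivity), mul_pow] at h1
    rw [div_mul_eq_mul_div, le_div_iff₀ (by positivity)]
    linarith
  calc (1 + t) ^ m * Real.exp (-(c * t ^ 2))
      ≤ (m.factorial / c ^ m * Real.exp (c * (1 + t))) * Real.exp (-(c * t ^ 2)) := by gcongr
    _ = m.factorial / c ^ m * Real.exp (c * (1 + t) + -(c * t ^ 2)) := by
        rw [Real.exp_add]; ring
    _ ≤ m.factorial / c ^ m * Real.exp (2 * c) := by
        gcongr
        nlinarith [mul_nonneg hc.le (sq_nonneg (t - 1)), mul_nonneg hc.le (sq_nonneg t)]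

theorem exp_comp_decay {E : Type*} [NormedAddCommGroup E] [NormedSpace ℝ E] {q : E → ℝ}
    (hq : Function.HasTemperateGrowth q) {c : ℝ} (hc : 0 < c)
    (hle : ∀ x, q x ≤ -(c * ‖x‖ ^ 2)) (k n : ℕ) :
    ∃ C : ℝ, ∀ x, ‖x‖ ^ k * ‖iteratedFDeriv ℝ n (Real.exp ∘ q) x‖ ≤ C := by
  obtain ⟨l, D, hD0, hD⟩ := hq.norm_iteratedFDeriv_le_uniform n
  obtain ⟨C, hC⟩ := pow_mul_exp_neg_sq_le hc (k + l * n)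
  refine ⟨n.factorial * (D + 1) ^ n * C, fun x ↦ ?_⟩
  have hx : 1 ≤ 1 + ‖x‖ := by linarith [norm_nonneg x]
  have hb : 1 ≤ (D + 1) * (1 + ‖x‖) ^ l := by
    have := one_le_pow₀ hx (n := l)
    nlinarith
  have h := norm_iteratedFDeriv_comp_le (n := n) (N := ((n : ℕ∞) : ℕ∞ω))
    (Real.contDiff_exp (n := ((n : ℕ∞) : ℕ∞ω))) (hq.1.of_le (by exact_mod_cast le_top))
    le_rfl x (C := Real.exp (q x)) (D := (D + 1) * (1 + ‖x‖) ^ l)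
    (fun i _ ↦ by
      rw [norm_iteratedFDeriv_eq_norm_iteratedDeriv, iteratedDeriv_eq_iterate, Real.iter_deriv_exp,
        Real.norm_of_nonneg (Real.exp_pos _).le])
    (fun i h1 hi ↦ by
      calc ‖iteratedFDeriv ℝ i q x‖ ≤ D * (1 + ‖x‖) ^ l := hD i hi x
        _ ≤ (D + 1) * (1 + ‖x‖) ^ l := by gcongr; linarith
        _ ≤ _ := le_self_pow₀ hb (by omega))
  calc ‖x‖ ^ k * ‖iteratedFDeriv ℝ n (Real.exp ∘ q) x‖
      ≤ (1 + ‖x‖) ^ k * (n.factorial * Real.exp (-(c * ‖x‖ ^ 2)) *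
          ((D + 1) * (1 + ‖x‖) ^ l) ^ n) := by
        gcongr
        · linarith
        · refine h.trans ?_
          gcongr
          exact hle x
    _ = n.factorial * (D + 1) ^ n *
          ((1 + ‖x‖) ^ (k + l * n) * Real.exp (-(c * ‖x‖ ^ 2))) := by
        rw [mul_pow, ← pow_mul, pow_add]; ring
    _ ≤ _ := by
        gcongr
        exact hC _ (norm_nonneg x)

/-- The Gaussian density `φ_S`, as a complex-valued Schwartz function on `ℝᵈ`. -/
def gaussianSchwartz {d : ℕ} (S : Matrix (Fin d) (Fin d) ℝ) (hS : S.PosDef) :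
    𝓢(EuclideanSpace ℝ (Fin d), ℂ) where
  toFun x := (gaussianDensity S x : ℂ)
  smooth' := by
    have h : ContDiff ℝ ∞ (gaussianDensity S) :=
      contDiff_const.mul (Real.contDiff_exp.comp (quadForm_hasTemperateGrowth S⁻¹).1)
    exact Complex.ofRealCLM.contDiff.comp h
  decay' := by
    intro k n
    have hq := quadForm_hasTemperateGrowth S⁻¹
    obtain ⟨c, hc, hle⟩ := quadForm_coercive hS.inv
    obtain ⟨C, hC⟩ := exp_comp_decay hq hc hle k n
    have hg : ContDiff ℝ ∞ (Real.exp ∘ fun x : EuclideanSpace ℝ (Fin d) ↦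
        -(1 / 2) * (x.ofLp ⬝ᵥ S⁻¹.mulVec x.ofLp)) := Real.contDiff_exp.comp hq.1
    set a : ℝ := ((2 * Real.pi) ^ d * S.det) ^ (-(1 / 2) : ℝ)
    set g := (Real.exp ∘ fun x : EuclideanSpace ℝ (Fin d) ↦
        -(1 / 2) * (x.ofLp ⬝ᵥ S⁻¹.mulVec x.ofLp))
    refine ⟨|a| * C, fun x ↦ ?_⟩
    have hn : ((n : ℕ∞) : ℕ∞ω) ≤ ∞ := by exact_mod_cast le_top
    have hag : ContDiff ℝ ∞ (a • g) := hg.const_smul a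
    have h1 : ‖iteratedFDeriv ℝ n (Complex.ofRealLI ∘ (a • g)) x‖ =
        ‖iteratedFDeriv ℝ n (a • g) x‖ :=
      Complex.ofRealLI.norm_iteratedFDeriv_comp_left hag.contDiffAt hn
    change ‖x‖ ^ k * ‖iteratedFDeriv ℝ n (Complex.ofRealLI ∘ (a • g)) x‖ ≤ |a| * C
    rw [h1, iteratedFDeriv_const_smul_apply (hg.of_le hn).contDiffAt, norm_smul, Real.norm_eq_abs]
    calc ‖x‖ ^ k * (|a| * ‖iteratedFDeriv ℝ n g x‖)
        = |a| * (‖x‖ ^ k * ‖iteratedFDeriv ℝ n g x‖) := by ring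
      _ ≤ |a| * C := by gcongr; exact hC x

/-- The covariance matrix `Σ_α` with unit variances and correlation `α`. -/
def covMatrix (α : ℝ) : Matrix (Fin 2) (Fin 2) ℝ := !![1, α; α, 1]

theorem covMatrix_posDef {α : ℝ} (hα : α ∈ Set.Ioo (-1 : ℝ) 1) : (covMatrix α).PosDef := by
  refine Matrix.PosDef.of_dotProduct_mulVec_pos ?_ fun x hx ↦ ?_
  · ext i j
    fin_cases i <;> fin_cases j <;> simp [covMatrix]
  · have h : x 0 ≠ 0 ∨ x 1 ≠ 0 := by
      by_contra! h
      apply hx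
      ext i
      fin_cases i
      · exact h.1
      · exact h.2
    have hsum : 0 < x 0 ^ 2 + x 1 ^ 2 := by
      rcases h with h | h <;> positivity
    obtain ⟨h1, h2⟩ := hα
    simp only [covMatrix, star_trivial, dotProduct, Matrix.mulVec, Fin.sum_univ_two,
      Matrix.of_apply, Matrix.cons_val_zero, Matrix.cons_val_one]
    rcases le_total 0 (x 0 * x 1) with hp | hp
    · nlinarith [sq_nonneg (x 0 - x 1), sq_nonneg (x 0 + x 1)]
    · nlinarith [sq_nonneg (x 0 - x 1), sq_nonneg (x 0 + x 1)]

/-- The function `Θ_f(α) = ⟨f, φ_{Σ_α}⟩` for `α ∈ (-1, 1)`. Only its values on `(-1, 1)` matter;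
it is given the value `0` elsewhere. -/
def theta (f : 𝓢'(EuclideanSpace ℝ (Fin 2), ℂ)) (α : ℝ) : ℂ :=
  open Classical in
  if hα : α ∈ Set.Ioo (-1 : ℝ) 1 then f (gaussianSchwartz (covMatrix α) (covMatrix_posDef hα))
  else 0

/-- The distributional derivative `∂^{2n} f / ∂x₁ⁿ ∂x₂ⁿ` of a tempered distribution on `ℝ²`. -/
def mixedDeriv (n : ℕ) (f : 𝓢'(EuclideanSpace ℝ (Fin 2), ℂ)) :
    𝓢'(EuclideanSpace ℝ (Fin 2), ℂ) :=
  ∂^{fun _ : Fin n ↦ EuclideanSpace.single (0 : Fin 2) (1 : ℝ)}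
    (∂^{fun _ : Fin n ↦ EuclideanSpace.single (1 : Fin 2) (1 : ℝ)} f)

end PriceTheorem

end

noncomputable section

open Filter Topology LineDeriv

/-! The Fourier transform of `φ_{Σ_α}` is `exp(-(ξ₁² + ξ₂² + 2αξ₁ξ₂)/2)`, and `∂/∂α` multiplies it
by `-ξ₁ξ₂`, the symbol of `∂₁∂₂`. Hence `∂φ/∂α = ∂²φ/∂x₁∂x₂`, checked here by direct computation.
Moving the two derivatives onto `f` gives `Θ_f' = Θ_{∂₁∂₂f}`, and induction over all `f` yields
smoothness and every derivative.

The analytic point is that `α ↦ φ_{Σ_α}` must be differentiable under an arbitrary tempered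
distribution, not only pointwise. With `s = α / √(1 - α²)`, the density is a scalar factor times the
slice at `s` of one fixed Schwartz function `W(s, x)` on `ℝ × ℝ²`; a factor `exp(-s²)` in `W`
supplies the decay in `s`. Moving the slice amounts to translating `W`, and translation is
differentiable in the Schwartz topology (`hasDerivAt_apply_compSubConstCLM`). The pointwise identity
then identifies the derivative (`hasDerivAt_theta`). -/

/-! ### Taylor remainders and translates of Schwartz functions -/

theorem norm_sub_sub_smul_le_of_norm_hasDerivAt_le {G : Type*} [NormedAddCommGroup G]
    [NormedSpace ℝ G] {u u' u'' : ℝ → G} {C h : ℝ} (hu : ∀ t, HasDerivAt u (u' t) t)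
    (hu' : ∀ t, HasDerivAt u' (u'' t) t) (hC : ∀ t ∈ Set.uIcc 0 h, ‖u'' t‖ ≤ C) :
    ‖u h - u 0 - h • u' 0‖ ≤ C * |h| ^ 2 := by
  have hC0 : 0 ≤ C := (norm_nonneg _).trans (hC 0 Set.left_mem_uIcc)
  -- The mean value inequality is used twice, for `u'` and then for `u s - s • u' 0`; this loses
  -- only Taylor's factor 1/2.
  have h1 : ∀ t ∈ Set.uIcc 0 h, ‖u' t - u' 0‖ ≤ C * |h| := by
    intro t ht
    refine (Convex.norm_image_sub_le_of_norm_hasDerivWithin_le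
      (fun s _ ↦ (hu' s).hasDerivWithinAt) hC (convex_uIcc 0 h) Set.left_mem_uIcc ht).trans ?_
    gcongr
    simpa using Set.abs_sub_left_of_mem_uIcc ht
  have h2 : ∀ t ∈ Set.uIcc 0 h,
      HasDerivWithinAt (fun s ↦ u s - s • u' 0) (u' t - u' 0) (Set.uIcc 0 h) t := by
    intro t _
    simpa using ((hu t).fun_sub ((hasDerivAt_id t).smul_const (u' 0))).hasDerivWithinAt
  have h3 := Convex.norm_image_sub_le_of_norm_hasDerivWithin_le h2 h1 (convex_uIcc 0 h)
    Set.left_mem_uIcc Set.right_mem_uIcc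
  have h4 : u h - h • u' 0 - (u 0 - (0 : ℝ) • u' 0) = u h - u 0 - h • u' 0 := by
    simp only [zero_smul]
    abel
  simp only [h4, sub_zero, Real.norm_eq_abs] at h3
  linarith [h3]

namespace SchwartzMap

variable {E F : Type*} [NormedAddCommGroup E] [NormedSpace ℝ E] [NormedAddCommGroup F]
  [NormedSpace ℝ F]

theorem lineDerivOp_lineDerivOp_apply (u v : E) (f : 𝓢(E, F)) (x : E) :
    ∂_{u} (∂_{v} f) x = fderiv ℝ (fderiv ℝ f) x u v := by
  have h : (∂_{v} f : 𝓢(E, F)) = fun y ↦ fderiv ℝ f y v := by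
    ext y
    rw [lineDerivOp_apply_eq_fderiv]
  have hd : DifferentiableAt ℝ (fderiv ℝ f) x :=
    ((f.smooth 2).fderiv_right (m := 1) (by norm_num)).differentiable one_ne_zero x
  rw [lineDerivOp_apply_eq_fderiv, h, fderiv_clm_apply hd (differentiableAt_const v)]
  simp

theorem lineDerivOp_comm (u v : E) (f : 𝓢(E, F)) : ∂_{u} (∂_{v} f) = ∂_{v} (∂_{u} f) := by
  ext x
  rw [lineDerivOp_lineDerivOp_apply, lineDerivOp_lineDerivOp_apply]
  exact ((f.contDiffAt 2).isSymmSndFDerivAt (by simp)).eq u v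

theorem iteratedLineDerivOp_lineDerivOp_comm {n : ℕ} (m : Fin n → E) (e : E) (f : 𝓢(E, F)) :
    ∂^{m} (∂_{e} f) = ∂_{e} (∂^{m} f) := by
  induction n with
  | zero => rfl
  | succ n ih => rw [iteratedLineDerivOp_succ_left, iteratedLineDerivOp_succ_left, ih,
      lineDerivOp_comm]

theorem iteratedLineDerivOp_compSubConstCLM {n : ℕ} (m : Fin n → E) (a : E) (f : 𝓢(E, F)) :
    ∂^{m} (compSubConstCLM ℝ a f) = compSubConstCLM ℝ a (∂^{m} f) := by
  ext x
  rw [iteratedLineDerivOp_eq_iteratedFDeriv, compSubConstCLM_apply,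
    iteratedLineDerivOp_eq_iteratedFDeriv, ← iteratedFDeriv_comp_sub n a x]
  rfl

theorem hasDerivAt_comp_add_smul (f : 𝓢(E, F)) (x e : E) (t : ℝ) :
    HasDerivAt (fun s : ℝ ↦ f (x + s • e)) (∂_{e} f (x + t • e)) t := by
  have h : HasDerivAt (fun s : ℝ ↦ x + s • e) e t := by
    simpa using ((hasDerivAt_id t).smul_const e).const_add x
  rw [lineDerivOp_apply_eq_fderiv]
  exact (f.hasFDerivAt (x + t • e)).comp_hasDerivAt t h

/-- Second-order Taylor expansion of each `∂^{m} f` along `e`. The bound is uniform in `x` because a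
shift by at most `‖e‖` changes the weight by a bounded factor. -/
theorem pow_mul_norm_iteratedFDeriv_remainder_le (e : E) (f : 𝓢(E, F)) (k n : ℕ) :
    ∃ C : ℝ, 0 ≤ C ∧ ∀ h : ℝ, |h| ≤ 1 → ∀ x, ‖x‖ ^ k * ‖iteratedFDeriv ℝ n
      (compSubConstCLM ℝ (-(h • e)) f - f - h • ∂_{e} f : 𝓢(E, F)) x‖ ≤ C * |h| ^ 2 := by
  set S := 2 ^ k * ((Finset.Iic (k, n + 2)).sup
    fun m ↦ SchwartzMap.seminorm ℝ m.1 m.2 : Seminorm ℝ 𝓢(E, F)) f with hS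
  have hS0 : 0 ≤ S := by positivity
  refine ⟨(1 + ‖e‖) ^ k * S * ‖e‖ ^ 2, by positivity, fun h hh x ↦ ?_⟩
  -- On fixed directions `m` the Fréchet derivative becomes `∂^{m}`, which commutes with translation
  -- and with `∂_{e}`.
  have key : ∀ m : Fin n → E, ‖x‖ ^ k * ‖iteratedFDeriv ℝ n
      (compSubConstCLM ℝ (-(h • e)) f - f - h • ∂_{e} f : 𝓢(E, F)) x m‖ ≤
      (1 + ‖e‖) ^ k * S * ‖e‖ ^ 2 * |h| ^ 2 * ∏ i, ‖m i‖ := by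
    intro m
    have h1 : iteratedFDeriv ℝ n
        (compSubConstCLM ℝ (-(h • e)) f - f - h • ∂_{e} f : 𝓢(E, F)) x m =
        (∂^{m} f) (x + h • e) - (∂^{m} f) (x + (0 : ℝ) • e) -
          h • (∂_{e} (∂^{m} f)) (x + (0 : ℝ) • e) := by
      rw [← iteratedLineDerivOp_eq_iteratedFDeriv]
      simp only [sub_eq_add_neg, iteratedLineDerivOp_add, iteratedLineDerivOp_neg,
        iteratedLineDerivOp_smul, iteratedLineDerivOp_compSubConstCLM,
        iteratedLineDerivOp_lineDerivOp_comm]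
      simp
    have hb : ∀ t ∈ Set.uIcc 0 h, ‖(‖x‖ ^ k) • (∂_{e} (∂_{e} (∂^{m} f))) (x + t • e)‖ ≤
        (1 + ‖e‖) ^ k * S * ‖e‖ ^ 2 * ∏ i, ‖m i‖ := by
      intro t ht
      have ht1 : |t| ≤ 1 := by
        have := Set.abs_sub_left_of_mem_uIcc ht
        simp only [sub_zero] at this
        exact this.trans hh
      have hx : ‖x‖ ≤ (1 + ‖e‖) * (1 + ‖x + t • e‖) := by
        have h2 : ‖x‖ ≤ ‖x + t • e‖ + ‖t • e‖ := by
          simpa using norm_sub_le (x + t • e) (t • e)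
        have h3 : ‖t • e‖ ≤ ‖e‖ := by
          rw [norm_smul, Real.norm_eq_abs]
          exact mul_le_of_le_one_left (norm_nonneg e) ht1
        nlinarith [norm_nonneg e, norm_nonneg (x + t • e)]
      have h4 : (∂_{e} (∂_{e} (∂^{m} f))) (x + t • e) = iteratedFDeriv ℝ (n + 2) f (x + t • e)
          (Fin.cons e (Fin.cons e m : Fin (n + 1) → E) : Fin (n + 2) → E) := by
        rw [← iteratedLineDerivOp_eq_iteratedFDeriv]
        rfl
      have h5 := one_add_le_sup_seminorm_apply (𝕜 := ℝ) (m := (k, n + 2)) le_rfl le_rfl f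
        (x + t • e)
      rw [← hS] at h5
      have h6 : ‖(∂_{e} (∂_{e} (∂^{m} f))) (x + t • e)‖ ≤
          ‖iteratedFDeriv ℝ (n + 2) f (x + t • e)‖ * (‖e‖ ^ 2 * ∏ i, ‖m i‖) := by
        rw [h4]
        refine (ContinuousMultilinearMap.le_opNorm _ _).trans_eq ?_
        simp only [Fin.prod_univ_succ, Fin.cons_zero, Fin.cons_succ]
        ring
      rw [norm_smul, norm_pow, norm_norm]
      calc ‖x‖ ^ k * ‖(∂_{e} (∂_{e} (∂^{m} f))) (x + t • e)‖
          ≤ ((1 + ‖e‖) * (1 + ‖x + t • e‖)) ^ k *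
            (‖iteratedFDeriv ℝ (n + 2) f (x + t • e)‖ * (‖e‖ ^ 2 * ∏ i, ‖m i‖)) := by
            gcongr
        _ = (1 + ‖e‖) ^ k * ((1 + ‖x + t • e‖) ^ k *
            ‖iteratedFDeriv ℝ (n + 2) f (x + t • e)‖) * (‖e‖ ^ 2 * ∏ i, ‖m i‖) := by
            rw [mul_pow]; ring
        _ ≤ (1 + ‖e‖) ^ k * S * (‖e‖ ^ 2 * ∏ i, ‖m i‖) := by gcongr
        _ = _ := by ring
    have h7 := norm_sub_sub_smul_le_of_norm_hasDerivAt_le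
      (fun t ↦ (hasDerivAt_comp_add_smul (∂^{m} f) x e t).const_smul (‖x‖ ^ k))
      (fun t ↦ (hasDerivAt_comp_add_smul (∂_{e} (∂^{m} f)) x e t).const_smul (‖x‖ ^ k)) hb
    simp only [Pi.smul_apply] at h7
    rw [smul_comm h, ← smul_sub, ← smul_sub, ← h1, norm_smul, norm_pow, norm_norm] at h7
    refine h7.trans_eq ?_
    ring
  -- A vanishing weight is split off, so that it can be divided out to reach the operator norm.
  rcases (pow_nonneg (norm_nonneg x) k).eq_or_lt with hx | hx
  · rw [← hx, zero_mul]
    positivity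
  rw [← le_div_iff₀' hx]
  refine ContinuousMultilinearMap.opNorm_le_bound (by positivity) fun m ↦ ?_
  rw [div_mul_eq_mul_div, le_div_iff₀' hx]
  exact key m

/-- In every seminorm the remainder is `O(h²)`, hence `O(h)` after division by `h`. -/
theorem tendsto_inv_smul_compSubConstCLM_sub (e : E) (f : 𝓢(E, F)) :
    Tendsto (fun h : ℝ ↦ h⁻¹ • (compSubConstCLM ℝ (-(h • e)) f - f)) (𝓝[≠] 0)
      (𝓝 (∂_{e} f)) := by
  rw [(schwartz_withSeminorms ℝ E F).tendsto_nhds]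
  rintro ⟨k, n⟩ ε hε
  obtain ⟨C, hC0, hC⟩ := pow_mul_norm_iteratedFDeriv_remainder_le e f k n
  have hlim : Tendsto (fun h : ℝ ↦ C * |h|) (𝓝[≠] 0) (𝓝 0) := by
    have : Continuous fun h : ℝ ↦ C * |h| := by fun_prop
    simpa using (this.tendsto 0).mono_left nhdsWithin_le_nhds
  have hone : ∀ᶠ h : ℝ in 𝓝[≠] 0, |h| ≤ 1 := by
    have : Tendsto (fun h : ℝ ↦ |h|) (𝓝[≠] 0) (𝓝 0) := by
      simpa using ((continuous_abs (G := ℝ)).tendsto 0).mono_left nhdsWithin_le_nhds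
    exact (this.eventually_lt_const one_pos).mono fun _ h ↦ h.le
  filter_upwards [hlim.eventually_lt_const hε, hone, self_mem_nhdsWithin] with h h1 h2 h3
  have h3 : h ≠ 0 := h3
  refine lt_of_le_of_lt ?_ h1
  have h4 : h⁻¹ • (compSubConstCLM ℝ (-(h • e)) f - f) - ∂_{e} f =
      h⁻¹ • (compSubConstCLM ℝ (-(h • e)) f - f - h • ∂_{e} f) := by
    rw [smul_sub h⁻¹ _ (h • _), inv_smul_smul₀ h3]
  rw [h4, map_smul_eq_mul, norm_inv, Real.norm_eq_abs]
  have h5 := seminorm_le_bound ℝ k n _ (by positivity) (hC h h2)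
  have h6 : 0 < |h| := abs_pos.mpr h3
  rw [schwartzSeminormFamily_apply, inv_mul_le_iff₀ h6]
  linarith

/-- Applying a continuous linear map to the translates of a Schwartz function along a line gives
a differentiable function of the translation parameter. -/
theorem hasDerivAt_apply_compSubConstCLM {G : Type*} [NormedAddCommGroup G] [NormedSpace ℝ G]
    (T : 𝓢(E, F) →L[ℝ] G) (e : E) (f : 𝓢(E, F)) (t : ℝ) :
    HasDerivAt (fun s : ℝ ↦ T (compSubConstCLM ℝ (-(s • e)) f))
      (T (compSubConstCLM ℝ (-(t • e)) (∂_{e} f))) t := by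
  rw [hasDerivAt_iff_tendsto_slope_zero]
  -- Translations form a group, so the slope at `t` is the slope at `0` followed by the continuous
  -- translation by `t`.
  have h := ((T ∘L compSubConstCLM ℝ (-(t • e))).continuous.tendsto (∂_{e} f)).comp
    (tendsto_inv_smul_compSubConstCLM_sub e f)
  refine h.congr fun s ↦ ?_
  simp only [Function.comp_apply, map_smul, map_sub, ContinuousLinearMap.comp_apply,
    compSubConstCLM_comp]
  congr 6
  rw [add_smul]
  abel

end SchwartzMap

/-! ### The bivariate density and its differential equation -/

namespace PriceTheorem

/-- The coordinate formula for the bivariate normal density with correlation `α`. -/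
def bivariateDensity (α a b : ℝ) : ℝ :=
  (2 * Real.pi * Real.sqrt (1 - α ^ 2))⁻¹ *
    Real.exp (-(1 / (2 * (1 - α ^ 2))) * (a ^ 2 + b ^ 2 - 2 * α * a * b))

theorem one_sub_sq_pos {α : ℝ} (hα : α ∈ Set.Ioo (-1 : ℝ) 1) : 0 < 1 - α ^ 2 := by
  nlinarith [hα.1, hα.2]

theorem gaussianDensity_covMatrix {α : ℝ} (hα : α ∈ Set.Ioo (-1 : ℝ) 1)
    (x : EuclideanSpace ℝ (Fin 2)) :
    gaussianDensity (covMatrix α) x = bivariateDensity α (x 0) (x 1) := by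
  have hd := one_sub_sq_pos hα
  have hdet : (covMatrix α).det = 1 - α ^ 2 := by
    simp [covMatrix, Matrix.det_fin_two]
    ring
  have hinv : (covMatrix α)⁻¹ = (1 - α ^ 2)⁻¹ • !![1, -α; -α, 1] := by
    rw [Matrix.inv_def, hdet, covMatrix, Matrix.adjugate_fin_two_of, Ring.inverse_eq_inv']
  have hpref : ((2 * Real.pi) ^ 2 * (1 - α ^ 2)) ^ (-(1 / 2) : ℝ) =
      (2 * Real.pi * Real.sqrt (1 - α ^ 2))⁻¹ := by
    rw [Real.rpow_neg (by positivity), ← Real.sqrt_eq_rpow, Real.sqrt_mul (by positivity),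
      Real.sqrt_sq (by positivity)]
  rw [gaussianDensity, bivariateDensity, hdet, hpref, hinv]
  congr 2
  simp [dotProduct, Matrix.mulVec, Fin.sum_univ_two]
  field_simp
  ring

theorem gaussianSchwartz_covMatrix_apply {α : ℝ} (hα : α ∈ Set.Ioo (-1 : ℝ) 1)
    (x : EuclideanSpace ℝ (Fin 2)) :
    gaussianSchwartz (covMatrix α) (covMatrix_posDef hα) x =
      (bivariateDensity α (x 0) (x 1) : ℂ) :=
  congrArg Complex.ofReal (gaussianDensity_covMatrix hα x)

theorem hasDerivAt_bivariateDensity_fst (α a b : ℝ) :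
    HasDerivAt (fun s ↦ bivariateDensity α s b)
      (bivariateDensity α a b * (-(a - α * b) / (1 - α ^ 2))) a := by
  unfold bivariateDensity
  have h : HasDerivAt (fun s : ℝ ↦ s ^ 2 + b ^ 2 - 2 * α * s * b) (2 * a - 2 * α * b) a := by
    have h1 := (hasDerivAt_pow 2 a).add_const (b ^ 2)
    have h2 := ((hasDerivAt_id a).const_mul (2 * α)).mul_const b
    simpa using h1.fun_sub h2
  refine (((h.const_mul (-(1 / (2 * (1 - α ^ 2))))).exp).const_mul
    (2 * Real.pi * Real.sqrt (1 - α ^ 2))⁻¹).congr_deriv ?_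
  -- When `α² = 1`, division by zero makes both sides vanish.
  by_cases hd : 1 - α ^ 2 = 0
  · simp [hd]
  field_simp

theorem bivariateDensity_swap (α a b : ℝ) :
    bivariateDensity α a b = bivariateDensity α b a := by
  unfold bivariateDensity
  congr 3
  ring

theorem hasDerivAt_bivariateDensity_snd (α a b : ℝ) :
    HasDerivAt (fun s ↦ bivariateDensity α a s)
      (bivariateDensity α a b * (-(b - α * a) / (1 - α ^ 2))) b := by
  simp_rw [bivariateDensity_swap α a]
  exact hasDerivAt_bivariateDensity_fst α b a

/-- The Gaussian densities satisfy `∂φ/∂α = ∂²φ/∂x₁∂x₂`; this is their common value. -/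
def bivariateDensityMixedDeriv (α a b : ℝ) : ℝ :=
  bivariateDensity α a b *
    ((a - α * b) * (b - α * a) / (1 - α ^ 2) ^ 2 + α / (1 - α ^ 2))

theorem hasDerivAt_bivariateDensity_fst_snd {α : ℝ} (hα : α ∈ Set.Ioo (-1 : ℝ) 1) (a b : ℝ) :
    HasDerivAt (fun s ↦ bivariateDensity α s b * (-(b - α * s) / (1 - α ^ 2)))
      (bivariateDensityMixedDeriv α a b) a := by
  have hd := (one_sub_sq_pos hα).ne'
  have h : HasDerivAt (fun s : ℝ ↦ -(b - α * s) / (1 - α ^ 2)) (α / (1 - α ^ 2)) a := by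
    simpa using ((((hasDerivAt_id a).const_mul α).const_sub b).fun_neg).div_const (1 - α ^ 2)
  refine ((hasDerivAt_bivariateDensity_fst α a b).fun_mul h).congr_deriv ?_
  unfold bivariateDensityMixedDeriv
  field_simp

theorem hasDerivAt_bivariateDensity_correlation {α : ℝ} (hα : α ∈ Set.Ioo (-1 : ℝ) 1)
    (a b : ℝ) :
    HasDerivAt (fun s ↦ bivariateDensity s a b) (bivariateDensityMixedDeriv α a b) α := by
  have hd := one_sub_sq_pos hα
  have hs : 0 < Real.sqrt (1 - α ^ 2) := Real.sqrt_pos.mpr hd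
  have hsq : Real.sqrt (1 - α ^ 2) ^ 2 = 1 - α ^ 2 := Real.sq_sqrt hd.le
  have h1 : HasDerivAt (fun s : ℝ ↦ 1 - s ^ 2) (-(2 * α)) α := by
    simpa using (hasDerivAt_pow 2 α).const_sub 1
  have h2 := ((h1.sqrt hd.ne').const_mul (2 * Real.pi)).fun_inv (by positivity)
  have h3 : HasDerivAt (fun s : ℝ ↦ -(1 / (2 * (1 - s ^ 2)))) (-α / (1 - α ^ 2) ^ 2) α := by
    simp only [one_div]
    refine (((h1.const_mul 2).fun_inv (by positivity)).fun_neg).congr_deriv ?_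
    field_simp
  have h4 : HasDerivAt (fun s : ℝ ↦ a ^ 2 + b ^ 2 - 2 * s * a * b) (-(2 * a * b)) α := by
    simpa using ((((hasDerivAt_id α).const_mul 2).mul_const a).mul_const b).const_sub
      (a ^ 2 + b ^ 2)
  refine (h2.fun_mul (h3.fun_mul h4).exp).congr_deriv ?_
  unfold bivariateDensityMixedDeriv bivariateDensity
  generalize Real.exp _ = y
  -- Writing `1 - α²` as `r²` reduces the claim to a polynomial identity modulo `α² = 1 - r²`.
  generalize hr : Real.sqrt (1 - α ^ 2) = r at *
  rw [← hsq]
  have hα2 : α ^ 2 = 1 - r ^ 2 := by linarith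
  have hr0 : r ≠ 0 := hs.ne'
  field_simp
  linear_combination (a * b * (1 : ℝ)) * y * hα2

theorem lineDerivOp_lineDerivOp_gaussianSchwartz_apply {α : ℝ} (hα : α ∈ Set.Ioo (-1 : ℝ) 1)
    (x : EuclideanSpace ℝ (Fin 2)) :
    (∂_{EuclideanSpace.single (0 : Fin 2) (1 : ℝ)} (∂_{EuclideanSpace.single (1 : Fin 2) (1 : ℝ)}
      (gaussianSchwartz (covMatrix α) (covMatrix_posDef hα)))) x =
      (bivariateDensityMixedDeriv α (x 0) (x 1) : ℂ) := by
  have h1 : ∀ y : EuclideanSpace ℝ (Fin 2),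
      (∂_{EuclideanSpace.single (1 : Fin 2) (1 : ℝ)}
        (gaussianSchwartz (covMatrix α) (covMatrix_posDef hα))) y =
        ((bivariateDensity α (y 0) (y 1) * (-(y 1 - α * y 0) / (1 - α ^ 2)) : ℝ) : ℂ) := by
    intro y
    rw [SchwartzMap.lineDerivOp_apply]
    refine HasLineDerivAt.lineDeriv ?_
    have h := (hasDerivAt_bivariateDensity_snd α (y 0) (y 1 + 0)).comp_const_add (y 1) 0
    rw [add_zero] at h
    refine h.ofReal_comp.congr_of_eventuallyEq (Eventually.of_forall fun t ↦ ?_)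
    simp [gaussianSchwartz_covMatrix_apply hα]
  rw [SchwartzMap.lineDerivOp_apply]
  refine HasLineDerivAt.lineDeriv ?_
  have h := (hasDerivAt_bivariateDensity_fst_snd hα (x 0 + 0) (x 1)).comp_const_add (x 0) 0
  rw [add_zero] at h
  refine h.ofReal_comp.congr_of_eventuallyEq (Eventually.of_forall fun t ↦ ?_)
  simp [h1]

/-! ### The densities as slices of one Schwartz function -/

/-- The exponent of the Gaussian density with correlation `s / √(1 + s²)`, damped in `s` by
`-s²`. -/
def dampedExponent (p : ℝ × EuclideanSpace ℝ (Fin 2)) : ℝ :=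
  -(1 / 2) * ((1 + p.1 ^ 2) * (p.2 0 ^ 2 + p.2 1 ^ 2)) +
    p.1 * (1 + ‖p.1‖ ^ 2) ^ (1 / 2 : ℝ) * (p.2 0 * p.2 1) - p.1 ^ 2

theorem dampedExponent_hasTemperateGrowth : Function.HasTemperateGrowth dampedExponent := by
  have hs : Function.HasTemperateGrowth fun p : ℝ × EuclideanSpace ℝ (Fin 2) ↦ p.1 :=
    (ContinuousLinearMap.fst ℝ ℝ (EuclideanSpace ℝ (Fin 2))).hasTemperateGrowth
  have hx : ∀ i, Function.HasTemperateGrowth fun p : ℝ × EuclideanSpace ℝ (Fin 2) ↦ p.2 i :=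
    fun i ↦ ((EuclideanSpace.proj i : EuclideanSpace ℝ (Fin 2) →L[ℝ] ℝ) ∘L
      ContinuousLinearMap.snd ℝ ℝ (EuclideanSpace ℝ (Fin 2))).hasTemperateGrowth
  have hJ : Function.HasTemperateGrowth fun p : ℝ × EuclideanSpace ℝ (Fin 2) ↦
      (1 + ‖p.1‖ ^ 2) ^ (1 / 2 : ℝ) :=
    (Function.hasTemperateGrowth_one_add_norm_sq_rpow ℝ (1 / 2)).comp hs
  have hc : ∀ c : ℝ, Function.HasTemperateGrowth
      fun _ : ℝ × EuclideanSpace ℝ (Fin 2) ↦ c := Function.HasTemperateGrowth.const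
  unfold dampedExponent
  simp only [pow_two] at hJ ⊢
  exact (((hc _).mul (((hc 1).add (hs.mul hs)).mul
    (((hx 0).mul (hx 0)).add ((hx 1).mul (hx 1))))).add
      ((hs.mul hJ).mul ((hx 0).mul (hx 1)))).sub (hs.mul hs)

theorem one_add_norm_sq_rpow_half (s : ℝ) :
    (1 + ‖s‖ ^ 2) ^ (1 / 2 : ℝ) = Real.sqrt (1 + s ^ 2) := by
  rw [← Real.sqrt_eq_rpow, Real.norm_eq_abs, sq_abs]

/-- Since `|s| √(1 + s²) ≤ s² + 1/2` and `|x₁x₂| ≤ ‖x‖²/2`, the cross term leaves `-‖x‖²/4 - s²`.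
The norm on the product is the maximum. -/
theorem dampedExponent_le (p : ℝ × EuclideanSpace ℝ (Fin 2)) :
    dampedExponent p ≤ -(1 / 4 * ‖p‖ ^ 2) := by
  obtain ⟨s, x⟩ := p
  have hx : ‖x‖ ^ 2 = x 0 ^ 2 + x 1 ^ 2 := by
    simp [EuclideanSpace.norm_sq_eq, Fin.sum_univ_two]
  have hJ : Real.sqrt (1 + s ^ 2) ^ 2 = 1 + s ^ 2 := Real.sq_sqrt (by positivity)
  have h1 : |s * Real.sqrt (1 + s ^ 2)| ≤ s ^ 2 + 1 / 2 := by
    rw [abs_le]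
    constructor <;> nlinarith [sq_nonneg (s - Real.sqrt (1 + s ^ 2)),
      sq_nonneg (s + Real.sqrt (1 + s ^ 2))]
  have h2 : |x 0 * x 1| ≤ (x 0 ^ 2 + x 1 ^ 2) / 2 := by
    rw [abs_le]
    constructor <;> nlinarith [sq_nonneg (x 0 - x 1), sq_nonneg (x 0 + x 1)]
  have h3 : s * Real.sqrt (1 + s ^ 2) * (x 0 * x 1) ≤
      (s ^ 2 + 1 / 2) * ((x 0 ^ 2 + x 1 ^ 2) / 2) := by
    refine (le_abs_self _).trans ?_
    rw [abs_mul]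
    gcongr
  have h4 : ‖(s, x)‖ ^ 2 ≤ s ^ 2 + (x 0 ^ 2 + x 1 ^ 2) := by
    rw [← hx, Prod.norm_mk]
    rcases max_cases ‖s‖ ‖x‖ with ⟨h, _⟩ | ⟨h, _⟩ <;> rw [h]
    · rw [Real.norm_eq_abs, sq_abs]
      nlinarith [sq_nonneg ‖x‖]
    · nlinarith [sq_nonneg s]
  simp only [dampedExponent, one_add_norm_sq_rpow_half]
  nlinarith [sq_nonneg s]

/-- The exponential of `dampedExponent`, as a Schwartz function of the correlation parameter and
the space variable jointly. -/
def dampedGaussian : 𝓢(ℝ × EuclideanSpace ℝ (Fin 2), ℂ) :=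
  SchwartzMap.postcompCLM (𝕜 := ℝ) Complex.ofRealCLM
    { toFun := Real.exp ∘ dampedExponent
      smooth' := Real.contDiff_exp.comp dampedExponent_hasTemperateGrowth.1
      decay' := exp_comp_decay dampedExponent_hasTemperateGrowth (by norm_num) dampedExponent_le }

theorem dampedGaussian_apply (p : ℝ × EuclideanSpace ℝ (Fin 2)) :
    dampedGaussian p = (Real.exp (dampedExponent p) : ℂ) := rfl

/-- Restriction of a Schwartz function on a product to the slice `{0} × E`. -/
def sliceCLM (E : Type*) [NormedAddCommGroup E] [NormedSpace ℝ E] :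
    𝓢(ℝ × E, ℂ) →L[ℂ] 𝓢(E, ℂ) :=
  SchwartzMap.compCLMOfAntilipschitz ℂ (K := 1) (g := fun x : E ↦ ((0 : ℝ), x))
    (ContinuousLinearMap.inr ℝ ℝ E).hasTemperateGrowth
    (AntilipschitzWith.of_le_mul_dist fun x y ↦ by simp [Prod.dist_eq])

theorem sliceCLM_apply {E : Type*} [NormedAddCommGroup E] [NormedSpace ℝ E]
    (g : 𝓢(ℝ × E, ℂ)) (x : E) : sliceCLM E g x = g (0, x) := rfl

/-- This turns dependence on the parameter `s` into translation followed by a fixed continuous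
linear map. -/
theorem sliceCLM_compSubConstCLM_apply {E : Type*} [NormedAddCommGroup E] [NormedSpace ℝ E]
    (g : 𝓢(ℝ × E, ℂ)) (s : ℝ) (x : E) :
    sliceCLM E (SchwartzMap.compSubConstCLM ℝ (-(s • ((1 : ℝ), (0 : E)))) g) x = g (s, x) := by
  simp [sliceCLM_apply]

/-- The parameter `s` for which `s / √(1 + s²)` is the correlation `α`. -/
def correlationParam (α : ℝ) : ℝ := α / Real.sqrt (1 - α ^ 2)

/-- The ratio of the Gaussian density to `dampedGaussian`. -/
def dampingFactor (α : ℝ) : ℝ :=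
  (2 * Real.pi * Real.sqrt (1 - α ^ 2))⁻¹ * Real.exp (correlationParam α ^ 2)

/-- The substitution gives `1 + s² = 1/(1 - α²)` and `s√(1 + s²) = α/(1 - α²)`, the coefficients of
the Gaussian exponent; `exp(s²)` undoes the damping. -/
theorem dampingFactor_mul_dampedGaussian {α : ℝ} (hα : α ∈ Set.Ioo (-1 : ℝ) 1)
    (x : EuclideanSpace ℝ (Fin 2)) :
    (dampingFactor α : ℂ) * dampedGaussian (correlationParam α, x) =
      (bivariateDensity α (x 0) (x 1) : ℂ) := by
  have hd := one_sub_sq_pos hα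
  have hs : 0 < Real.sqrt (1 - α ^ 2) := Real.sqrt_pos.mpr hd
  have h1 : 1 + correlationParam α ^ 2 = (1 - α ^ 2)⁻¹ := by
    rw [correlationParam, div_pow, Real.sq_sqrt hd.le]
    field_simp
    ring
  have h2 : correlationParam α * Real.sqrt (1 + correlationParam α ^ 2) = α / (1 - α ^ 2) := by
    rw [h1, correlationParam, Real.sqrt_inv, div_mul_eq_mul_div, ← div_eq_mul_inv, div_div,
      Real.mul_self_sqrt hd.le]
  rw [dampedGaussian_apply, dampingFactor, bivariateDensity, ← Complex.ofReal_mul, mul_assoc,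
    ← Real.exp_add]
  congr 3
  simp only [dampedExponent, one_add_norm_sq_rpow_half]
  rw [h2, h1]
  field_simp
  ring

theorem differentiableAt_correlationParam {α : ℝ} (hα : α ∈ Set.Ioo (-1 : ℝ) 1) :
    DifferentiableAt ℝ correlationParam α := by
  have hd := one_sub_sq_pos hα
  have hs : DifferentiableAt ℝ (fun s : ℝ ↦ Real.sqrt (1 - s ^ 2)) α :=
    DifferentiableAt.sqrt (by fun_prop) hd.ne'
  exact differentiableAt_id.fun_div hs (Real.sqrt_pos.mpr hd).ne'

theorem differentiableAt_dampingFactor {α : ℝ} (hα : α ∈ Set.Ioo (-1 : ℝ) 1) :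
    DifferentiableAt ℝ dampingFactor α := by
  have hd := one_sub_sq_pos hα
  have hs : DifferentiableAt ℝ (fun s : ℝ ↦ Real.sqrt (1 - s ^ 2)) α :=
    DifferentiableAt.sqrt (by fun_prop) hd.ne'
  have hs0 : 0 < Real.sqrt (1 - α ^ 2) := Real.sqrt_pos.mpr hd
  exact ((hs.const_mul _).fun_inv (by positivity)).fun_mul
    ((differentiableAt_correlationParam hα).fun_pow 2).exp

/-! ### Differentiating the pairing -/

theorem theta_of_mem (f : 𝓢'(EuclideanSpace ℝ (Fin 2), ℂ)) {α : ℝ}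
    (hα : α ∈ Set.Ioo (-1 : ℝ) 1) :
    theta f α = f (gaussianSchwartz (covMatrix α) (covMatrix_posDef hα)) :=
  dif_pos hα

/-- The product and chain rules give the derivative as `f` of some Schwartz function; it is
recognised pointwise, without computing `σ'` or `K'`. -/
theorem hasDerivAt_theta (f : 𝓢'(EuclideanSpace ℝ (Fin 2), ℂ)) {α : ℝ}
    (hα : α ∈ Set.Ioo (-1 : ℝ) 1) :
    HasDerivAt (theta f)
      (f (∂_{EuclideanSpace.single (0 : Fin 2) (1 : ℝ)}
        (∂_{EuclideanSpace.single (1 : Fin 2) (1 : ℝ)}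
          (gaussianSchwartz (covMatrix α) (covMatrix_posDef hα))))) α := by
  set E := EuclideanSpace ℝ (Fin 2)
  set e : ℝ × E := (1, 0)
  set W := dampedGaussian
  set σ' := deriv correlationParam α
  set K' := deriv dampingFactor α
  have hσ : HasDerivAt correlationParam σ' α := (differentiableAt_correlationParam hα).hasDerivAt
  have hK : HasDerivAt dampingFactor K' α := (differentiableAt_dampingFactor hα).hasDerivAt
  set sl : ℝ → 𝓢(ℝ × E, ℂ) → 𝓢(E, ℂ) :=
    fun s g ↦ sliceCLM E (SchwartzMap.compSubConstCLM ℝ (-(s • e)) g)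
  have hsl : ∀ s g x, sl s g x = g (s, x) := fun s g x ↦ sliceCLM_compSubConstCLM_apply g s x
  let T : 𝓢(ℝ × E, ℂ) →L[ℝ] ℂ :=
    (ContinuousLinearMap.comp (f : 𝓢(E, ℂ) →L[ℂ] ℂ) (sliceCLM E)).restrictScalars ℝ
  have hT : ∀ s, HasDerivAt (fun s ↦ f (sl s W)) (f (sl s (∂_{e} W))) s :=
    fun s ↦ SchwartzMap.hasDerivAt_apply_compSubConstCLM T e W s
  have hθ : ∀ᶠ β in 𝓝 α, theta f β = (dampingFactor β : ℂ) * f (sl (correlationParam β) W) := by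
    filter_upwards [isOpen_Ioo.mem_nhds hα] with β hβ
    rw [theta_of_mem f hβ, ← smul_eq_mul, ← map_smul]
    congr 1
    ext x
    rw [gaussianSchwartz_covMatrix_apply hβ, smul_apply, hsl, smul_eq_mul,
      dampingFactor_mul_dampedGaussian hβ]
  have hD := (hK.ofReal_comp.fun_mul ((hT (correlationParam α)).scomp α hσ)).congr_of_eventuallyEq
    hθ
  refine hD.congr_deriv ?_
  -- At each `x` both sides are the `α`-derivative of the density, so uniqueness of derivatives
  -- applies.
  have hvec : (∂_{EuclideanSpace.single (0 : Fin 2) (1 : ℝ)}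
        (∂_{EuclideanSpace.single (1 : Fin 2) (1 : ℝ)}
          (gaussianSchwartz (covMatrix α) (covMatrix_posDef hα)))) =
      (K' : ℂ) • sl (correlationParam α) W +
        (dampingFactor α : ℂ) • (σ' : ℂ) • sl (correlationParam α) (∂_{e} W) := by
    ext x
    rw [lineDerivOp_lineDerivOp_gaussianSchwartz_apply hα]
    have h1 := (hasDerivAt_bivariateDensity_correlation hα (x 0) (x 1)).ofReal_comp
    have h2 : HasDerivAt (fun s ↦ W (s, x)) ((∂_{e} W) (correlationParam α, x))
        (correlationParam α) := by
      simpa [e] using W.hasDerivAt_comp_add_smul ((0 : ℝ), x) e (correlationParam α)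
    have h3 := hK.ofReal_comp.fun_mul (h2.scomp α hσ)
    refine (h1.unique (h3.congr_of_eventuallyEq ?_)).trans ?_
    · filter_upwards [isOpen_Ioo.mem_nhds hα] with β hβ
      exact (dampingFactor_mul_dampedGaussian hβ x).symm
    · simp [hsl]
  rw [hvec, map_add, map_smul, map_smul, map_smul]
  simp

theorem lineDerivOp_comm {E : Type*} [NormedAddCommGroup E] [NormedSpace ℝ E] (u v : E)
    (f : 𝓢'(E, ℂ)) : ∂_{u} (∂_{v} f) = ∂_{v} (∂_{u} f) := by
  ext g
  simp only [TemperedDistribution.lineDerivOp_apply_apply, lineDerivOp_neg, neg_neg]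
  rw [SchwartzMap.lineDerivOp_comm]

/-- The distributional derivative `∂²f / ∂x₁∂x₂`. -/
def mixedDerivOnce (f : 𝓢'(EuclideanSpace ℝ (Fin 2), ℂ)) : 𝓢'(EuclideanSpace ℝ (Fin 2), ℂ) :=
  ∂_{EuclideanSpace.single (0 : Fin 2) (1 : ℝ)} (∂_{EuclideanSpace.single (1 : Fin 2) (1 : ℝ)} f)

/-- Commuting the two partial derivatives regroups `∂₁ⁿ∂₂ⁿ` as `(∂₁∂₂)ⁿ`. -/
theorem mixedDeriv_eq_iterate (n : ℕ) (f : 𝓢'(EuclideanSpace ℝ (Fin 2), ℂ)) :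
    mixedDeriv n f = mixedDerivOnce^[n] f := by
  have h : Function.Commute
      (fun g : 𝓢'(EuclideanSpace ℝ (Fin 2), ℂ) ↦ ∂_{EuclideanSpace.single (0 : Fin 2) (1 : ℝ)} g)
      (fun g ↦ ∂_{EuclideanSpace.single (1 : Fin 2) (1 : ℝ)} g) := fun g ↦ lineDerivOp_comm _ _ g
  rw [mixedDeriv, iteratedLineDerivOp_const_eq_iter_lineDerivOp,
    iteratedLineDerivOp_const_eq_iter_lineDerivOp]
  exact (congrFun (h.comp_iterate n) f).symm

theorem hasDerivAt_theta_mixedDerivOnce (f : 𝓢'(EuclideanSpace ℝ (Fin 2), ℂ)) {α : ℝ}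
    (hα : α ∈ Set.Ioo (-1 : ℝ) 1) : HasDerivAt (theta f) (theta (mixedDerivOnce f) α) α := by
  refine (hasDerivAt_theta f hα).congr_deriv ?_
  -- Duality reverses the order of the derivatives, hence the swap; the two minus signs cancel.
  rw [theta_of_mem _ hα, mixedDerivOnce, lineDerivOp_comm]
  simp only [TemperedDistribution.lineDerivOp_apply_apply, lineDerivOp_neg, neg_neg]

theorem contDiffOn_theta (n : ℕ) (f : 𝓢'(EuclideanSpace ℝ (Fin 2), ℂ)) :
    ContDiffOn ℝ n (theta f) (Set.Ioo (-1 : ℝ) 1) := by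
  have hd (f : 𝓢'(EuclideanSpace ℝ (Fin 2), ℂ)) :
      DifferentiableOn ℝ (theta f) (Set.Ioo (-1 : ℝ) 1) := fun α hα ↦
    (hasDerivAt_theta_mixedDerivOnce f hα).differentiableAt.differentiableWithinAt
  induction n generalizing f with
  | zero => exact contDiffOn_zero.mpr (hd f).continuousOn
  | succ n ih =>
    push_cast
    rw [contDiffOn_succ_iff_deriv_of_isOpen isOpen_Ioo]
    refine ⟨hd f, by simp, (ih (mixedDerivOnce f)).congr fun α hα ↦ ?_⟩
    exact (hasDerivAt_theta_mixedDerivOnce f hα).deriv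

theorem iteratedDeriv_theta (n : ℕ) (f : 𝓢'(EuclideanSpace ℝ (Fin 2), ℂ)) {α : ℝ}
    (hα : α ∈ Set.Ioo (-1 : ℝ) 1) :
    iteratedDeriv n (theta f) α = theta (mixedDeriv n f) α := by
  rw [mixedDeriv_eq_iterate]
  induction n generalizing f with
  | zero => simp
  | succ n ih =>
    -- Equality near `α` is needed because further derivatives are taken.
    have h : deriv (theta f) =ᶠ[𝓝 α] theta (mixedDerivOnce f) := by
      filter_upwards [isOpen_Ioo.mem_nhds hα] with β hβ
      exact (hasDerivAt_theta_mixedDerivOnce f hβ).deriv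
    rw [iteratedDeriv_succ', h.iteratedDeriv_eq, ih, Function.iterate_succ_apply]

end PriceTheorem

end

theorem mainTheorem2 (f : 𝓢'(EuclideanSpace ℝ (Fin 2), ℂ)) :
    (∀ (α : ℝ) (hα : α ∈ Set.Ioo (-1 : ℝ) 1) (x : EuclideanSpace ℝ (Fin 2)),
      PriceTheorem.gaussianSchwartz (PriceTheorem.covMatrix α) (PriceTheorem.covMatrix_posDef hα) x =
        (((2 * Real.pi * Real.sqrt (1 - α ^ 2))⁻¹ *
          Real.exp (-(1 / (2 * (1 - α ^ 2))) *
            (x 0 ^ 2 + x 1 ^ 2 - 2 * α * x 0 * x 1)) : ℝ) : ℂ)) ∧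
    ContDiffOn ℝ ∞ (PriceTheorem.theta f) (Set.Ioo (-1 : ℝ) 1) ∧
    ∀ (n : ℕ) (α : ℝ) (hα : α ∈ Set.Ioo (-1 : ℝ) 1),
      iteratedDeriv n (PriceTheorem.theta f) α =
        PriceTheorem.mixedDeriv n f
          (PriceTheorem.gaussianSchwartz (PriceTheorem.covMatrix α)
            (PriceTheorem.covMatrix_posDef hα)) := by
  refine ⟨fun α hα x ↦ PriceTheorem.gaussianSchwartz_covMatrix_apply hα x,
    contDiffOn_infty.mpr fun n ↦ PriceTheorem.contDiffOn_theta n f, fun n α hα ↦ ?_⟩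
  rw [PriceTheorem.iteratedDeriv_theta n f hα, PriceTheorem.theta_of_mem _ hα]
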